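/- Let $k$ be an algebraically closed field of characteristic zero, let $n\ge 0$, and let $k[[x]]=k[[x_1,\dots,x_n]]$ be the algebra of formal power series in $n$ commuting variables over $k$. Let $\varphi$ be a $k$-algebra endomorphism of $k[[x]]$ which is locally finite, i.e., for every $a\in k[[x]]$ the $k$-subspace spanned by the elements $\varphi^m(a)$, $m\ge 0$, is finite dimensional. Then there exist an integer $N\ge 1$, an integer $d$ with $0\le d\le n$, roots of unity $c_1,\dots,c_d\in k$, and coordinates $y_1,\dots,y_n$ of $k[[x]]$, such that $\varphi(y_i)=c_iy_i$ for all $1\le i\le d$ and $\varphi^N(y_i)=0$ for all $d<i\le n$. Here coordinates means $k[[x]]=k[[y_1,\dots,y_n]]$, i.e., the $y_i$ have zero constant term and every element of $k[[x]]$ can be written as $g(y_1,\dots,y_n)$ for exactly one formal power series $g$ in $n$ variables over $k$. -/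

import Mathlib

/-- A `k`-algebra endomorphism `φ` of `A` is locally finite if for each `a : A` the `k`-subspace
spanned by the elements `φ^m(a)`, `m ≥ 0`, is finite dimensional over `k`. -/
def IsLocallyFiniteEnd {k A : Type*} [Field k] [CommRing A] [Algebra k A]
    (φ : A →ₐ[k] A) : Prop :=
  ∀ a : A, FiniteDimensional k
    (Submodule.span k (Set.range fun m : ℕ => (φ ^ m) a) : Submodule k A)

/-- `y₁, …, yₙ` are coordinates of `k[[x₁, …, xₙ]]`, i.e. `k[[x]] = k[[y]]`: power series may be
evaluated at `y` (over a field: the `yᵢ` have zero constant term), and every element of `k[[x]]` is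
`g(y)` for exactly one formal power series `g` in `n` variables. -/
def IsPowerSeriesCoordinates {k : Type*} [Field k] {n : ℕ}
    (y : Fin n → MvPowerSeries (Fin n) k) : Prop :=
  MvPowerSeries.HasSubst y ∧
    Function.Bijective
      (fun g : MvPowerSeries (Fin n) k => (MvPowerSeries.subst y g : MvPowerSeries (Fin n) k))

/-! Local finiteness over an algebraically closed field makes `k[[x]]` the sum of the generalized
eigenspaces of `φ`. The linear parts of generalized eigenvectors without constant term therefore
span `k^n` (`span_linearPart_maxGenEigenspace`). Choosing `n` of them with independent linear parts
gives coordinates, by the formal inverse function theorem. Those with eigenvalue `0` are killed by a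
power of `φ`.

For `μ ≠ 0` one device works twice: a series `∑ aₗ` of rapidly growing order is killed by some
nonzero `P(φ)`, and comparing orders constrains each term. With powers of an eigenvector it forces
`P(μ^j) = 0` for all `j`, so `μ` is a root of unity. A nontrivial Jordan block would then give a
power `ψ` of `φ` with `ψ y = y + w`, `ψ w = w`, `w ≠ 0`; sparse powers of `y` exclude this
(`eq_zero_of_map_eq_add_of_isLocallyFiniteEnd`). -/

namespace MvPowerSeries

/-! ### The order filtration -/

section OrderIdeal

variable {σ k : Type*} [Field k]

/-- The ideal of power series of order at least `d`. -/
def orderIdeal (σ k : Type*) [Field k] (d : ℕ) : Ideal (MvPowerSeries σ k) where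
  carrier := {f | (d : ℕ∞) ≤ f.order}
  add_mem' ha hb := (le_min ha hb).trans min_order_le_add
  zero_mem' := by simp
  smul_mem' c f hf := by
    have h : (d : ℕ∞) ≤ f.order := hf
    exact h.trans (le_add_self.trans le_order_mul)

theorem mem_orderIdeal {d : ℕ} {f : MvPowerSeries σ k} :
    f ∈ orderIdeal σ k d ↔ (d : ℕ∞) ≤ f.order := Iff.rfl

theorem mem_orderIdeal_iff_coeff {d : ℕ} {f : MvPowerSeries σ k} :
    f ∈ orderIdeal σ k d ↔ ∀ e, Finsupp.degree e < d → coeff e f = 0 := by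
  refine ⟨fun h e he => coeff_of_lt_order (lt_of_lt_of_le (by exact_mod_cast he) h),
    fun h => nat_le_order h⟩

theorem mul_mem_orderIdeal {a b : ℕ} {f g : MvPowerSeries σ k} (hf : f ∈ orderIdeal σ k a)
    (hg : g ∈ orderIdeal σ k b) : f * g ∈ orderIdeal σ k (a + b) := by
  rw [mem_orderIdeal] at *
  push_cast
  exact (add_le_add hf hg).trans le_order_mul

theorem pow_mem_orderIdeal {a : ℕ} {f : MvPowerSeries σ k} (hf : f ∈ orderIdeal σ k a) (j : ℕ) :
    f ^ j ∈ orderIdeal σ k (j * a) := by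
  rw [mem_orderIdeal] at *
  refine le_trans ?_ (le_order_pow j)
  rw [nsmul_eq_mul]
  push_cast
  gcongr

theorem mem_orderIdeal_one {f : MvPowerSeries σ k} :
    f ∈ orderIdeal σ k 1 ↔ constantCoeff f = 0 := by
  rw [mem_orderIdeal, ← one_le_order_iff_constCoeff_eq_zero]
  simp

theorem mem_orderIdeal_zero (f : MvPowerSeries σ k) : f ∈ orderIdeal σ k 0 := by
  simp [mem_orderIdeal]

theorem X_mem_orderIdeal (i : σ) : (X i : MvPowerSeries σ k) ∈ orderIdeal σ k 1 :=
  mem_orderIdeal_one.2 (by simp)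

theorem eq_zero_of_forall_mem_orderIdeal {f : MvPowerSeries σ k}
    (h : ∀ d, f ∈ orderIdeal σ k d) : f = 0 := by
  ext e
  exact mem_orderIdeal_iff_coeff.1 (h (Finsupp.degree e + 1)) e (Nat.lt_succ_self _)

theorem smul_mem_orderIdeal {d : ℕ} (c : k) {f : MvPowerSeries σ k}
    (hf : f ∈ orderIdeal σ k d) : c • f ∈ orderIdeal σ k d := by
  rw [smul_eq_C_mul]
  exact Ideal.mul_mem_left _ _ hf

theorem exists_coeff_eq (F : (σ →₀ ℕ) → k) :
    ∃ f : MvPowerSeries σ k, ∀ e, coeff e f = F e :=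
  ⟨F, fun _ => rfl⟩

/-- Convergence of series whose terms have order tending to infinity. -/
theorem exists_sub_sum_mem_orderIdeal (a : ℕ → MvPowerSeries σ k) (b : ℕ → ℕ) (hb : Monotone b)
    (hb' : ∀ l, l ≤ b l) (ha : ∀ l, a l ∈ orderIdeal σ k (b l)) :
    ∃ f : MvPowerSeries σ k, ∀ L, f - ∑ l ∈ Finset.range L, a l ∈ orderIdeal σ k (b L) := by
  obtain ⟨f, hf⟩ := exists_coeff_eq fun e =>
    ∑ l ∈ Finset.range (Finsupp.degree e + 1), coeff e (a l)
  refine ⟨f, fun L => ?_⟩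
  rw [mem_orderIdeal_iff_coeff]
  intro e he
  rw [map_sub, map_sum, sub_eq_zero, hf]
  have h0 : ∀ l, Finsupp.degree e < b l → coeff e (a l) = 0 :=
    fun l hl => mem_orderIdeal_iff_coeff.1 (ha l) e hl
  rcases le_total (Finsupp.degree e + 1) L with h | h
  · refine Finset.sum_subset (Finset.range_mono h) fun l _ hl => h0 l ?_
    have := hb' l
    simp at hl
    omega
  · refine (Finset.sum_subset (Finset.range_mono h) fun l _ hl => h0 l ?_).symm
    simp at hl
    exact he.trans_le (hb hl)

/-- Each nonconstant monomial is assigned to one variable dividing it, by the choice function `p`.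
This permits induction on order for endomorphisms not assumed continuous. -/
theorem exists_eq_sum_X_mul [Fintype σ] {d : ℕ} {f : MvPowerSeries σ k}
    (hf : f ∈ orderIdeal σ k (d + 1)) :
    ∃ g : σ → MvPowerSeries σ k, (∀ i, g i ∈ orderIdeal σ k d) ∧ f = ∑ i, X i * g i := by
  classical
  have hp : ∀ e : σ →₀ ℕ, ∃ i : Option σ, (e ≠ 0 → ∃ j, i = some j ∧ e j ≠ 0) := by
    intro e
    by_cases he : e = 0
    · exact ⟨none, fun h => absurd he h⟩
    · obtain ⟨j, hj⟩ := Finsupp.ne_iff.1 he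
      exact ⟨some j, fun _ => ⟨j, rfl, by simpa using hj⟩⟩
  choose p hp using hp
  choose g hg using fun i => exists_coeff_eq fun e =>
    if p (e + Finsupp.single i 1) = some i then coeff (e + Finsupp.single i 1) f else 0
  refine ⟨g, fun i => ?_, ?_⟩
  · rw [mem_orderIdeal_iff_coeff] at *
    intro e he
    rw [hg]
    split_ifs
    · apply hf
      simp
      omega
    · rfl
  · ext e
    rw [map_sum]
    by_cases he : e = 0
    · subst he
      rw [mem_orderIdeal_iff_coeff.1 hf 0 (by simp)]
      simp
    · obtain ⟨j, hj, hej⟩ := hp e he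
      have hle : Finsupp.single j 1 ≤ e := by
        simpa using Nat.one_le_iff_ne_zero.2 hej
      rw [Finset.sum_eq_single j]
      · rw [X, coeff_monomial_mul, if_pos hle, one_mul, hg, tsub_add_cancel_of_le hle, if_pos hj]
      · intro i _ hi
        rw [X, coeff_monomial_mul]
        split_ifs with h
        · rw [one_mul, hg, tsub_add_cancel_of_le h, if_neg]
          rw [hj]
          simpa using hi.symm
        · rfl
      · simp

end OrderIdeal

/-! ### Endomorphisms, orders and linear parts -/

section AlgHom

variable {σ k : Type*} [Field k]

/-- Otherwise `f - c`, with `c` the constant term of `T f`, is a unit sent to a nonunit. -/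
theorem constantCoeff_algHom (T : MvPowerSeries σ k →ₐ[k] MvPowerSeries σ k)
    (f : MvPowerSeries σ k) : constantCoeff (T f) = constantCoeff f := by
  by_contra h
  set c := constantCoeff (T f)
  have h1 : IsUnit (f - C c) := by
    rw [isUnit_iff_constantCoeff]
    rw [map_sub, constantCoeff_C]
    exact IsUnit.mk0 _ (sub_ne_zero.2 (Ne.symm h))
  have h2 := h1.map T
  rw [isUnit_iff_constantCoeff] at h2
  have hC : T (C c) = C c := by simpa [algebraMap_apply] using T.commutes c
  rw [map_sub, hC, map_sub, constantCoeff_C] at h2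
  exact h2.ne_zero (sub_self _)

section Fintype

variable [Fintype σ]

theorem algHom_mem_orderIdeal (T : MvPowerSeries σ k →ₐ[k] MvPowerSeries σ k) {d : ℕ}
    {f : MvPowerSeries σ k} (hf : f ∈ orderIdeal σ k d) : T f ∈ orderIdeal σ k d := by
  induction d generalizing f with
  | zero => exact mem_orderIdeal_zero _
  | succ d ih =>
    obtain ⟨g, hg, rfl⟩ := exists_eq_sum_X_mul hf
    rw [map_sum]
    refine Ideal.sum_mem _ fun i _ => ?_
    rw [map_mul, add_comm]
    refine mul_mem_orderIdeal (mem_orderIdeal_one.2 ?_) (ih (hg i))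
    rw [constantCoeff_algHom]
    simp

theorem algHom_sub_self_mem_orderIdeal (T : MvPowerSeries σ k →ₐ[k] MvPowerSeries σ k)
    (hT : ∀ i, T (X i) - X i ∈ orderIdeal σ k 2) {d : ℕ}
    {f : MvPowerSeries σ k} (hf : f ∈ orderIdeal σ k d) : T f - f ∈ orderIdeal σ k (d + 1) := by
  induction d generalizing f with
  | zero =>
    rw [zero_add, mem_orderIdeal_one, map_sub, constantCoeff_algHom, sub_self]
  | succ d ih =>
    obtain ⟨g, hg, rfl⟩ := exists_eq_sum_X_mul hf
    rw [map_sum, ← Finset.sum_sub_distrib]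
    refine Ideal.sum_mem _ fun i _ => ?_
    have h : T (X i * g i) - X i * g i = (T (X i) - X i) * T (g i) + X i * (T (g i) - g i) := by
      rw [map_mul]; ring
    rw [h]
    refine Ideal.add_mem _ ?_ ?_
    · have := mul_mem_orderIdeal (hT i) (algHom_mem_orderIdeal T (hg i))
      rwa [show d + 1 + 1 = 2 + d by ring]
    · have := mul_mem_orderIdeal (X_mem_orderIdeal i) (ih (hg i))
      rwa [show d + 1 + 1 = 1 + (d + 1) by ring]

/-- An endomorphism of the power series algebra that is tangent to the identity is bijective. -/
theorem bijective_of_sub_X_mem_orderIdeal (T : MvPowerSeries σ k →ₐ[k] MvPowerSeries σ k)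
    (hT : ∀ i, T (X i) - X i ∈ orderIdeal σ k 2) : Function.Bijective T := by
  constructor
  · rw [injective_iff_map_eq_zero]
    intro f hf
    refine eq_zero_of_forall_mem_orderIdeal fun d => ?_
    induction d with
    | zero => exact mem_orderIdeal_zero _
    | succ d ih =>
      have := algHom_sub_self_mem_orderIdeal T hT ih
      rw [hf, zero_sub] at this
      exact (Submodule.neg_mem_iff _).1 this
  · intro g
    -- Neumann series: the preimage of `g` is `∑ (1 - T)^l g`.
    let a : ℕ → MvPowerSeries σ k := fun l => (fun h => h - T h)^[l] g
    have hs : ∀ l, a (l + 1) = a l - T (a l) := fun l => Function.iterate_succ_apply' _ _ _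
    have ha : ∀ l, a l ∈ orderIdeal σ k l := by
      intro l
      induction l with
      | zero => exact mem_orderIdeal_zero _
      | succ l ih =>
        rw [hs, ← neg_sub, Submodule.neg_mem_iff]
        exact algHom_sub_self_mem_orderIdeal T hT ih
    obtain ⟨f, hf⟩ := exists_sub_sum_mem_orderIdeal a id monotone_id (fun _ => le_rfl) ha
    refine ⟨f, sub_eq_zero.1 (eq_zero_of_forall_mem_orderIdeal fun L => ?_)⟩
    have hsum : T (∑ l ∈ Finset.range L, a l) = g - a L := by
      rw [map_sum, ← neg_sub (a L), show g = a 0 from rfl, ← Finset.sum_range_sub,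
        ← Finset.sum_neg_distrib]
      exact Finset.sum_congr rfl fun l _ => by rw [hs]; ring
    have h : T f - g = T (f - ∑ l ∈ Finset.range L, a l) - a L := by
      rw [map_sub, hsum]; ring
    rw [h]
    exact Ideal.sub_mem _ (algHom_mem_orderIdeal T (hf L)) (ha L)

end Fintype

/-- The linear part of a power series, as its vector of coefficients. -/
noncomputable def linearPart (σ k : Type*) [Field k] : MvPowerSeries σ k →ₗ[k] (σ → k) :=
  LinearMap.pi fun i => coeff (Finsupp.single i 1)

theorem linearPart_apply (f : MvPowerSeries σ k) (i : σ) :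
    linearPart σ k f i = coeff (Finsupp.single i 1) f := rfl

theorem linearPart_X [DecidableEq σ] (i : σ) :
    linearPart σ k (X i) = Pi.single i 1 := by
  ext j
  rw [linearPart_apply, coeff_X, Pi.single_apply]
  simp [Finsupp.single_left_inj]

theorem mem_orderIdeal_two {f : MvPowerSeries σ k} :
    f ∈ orderIdeal σ k 2 ↔ constantCoeff f = 0 ∧ linearPart σ k f = 0 := by
  rw [mem_orderIdeal_iff_coeff]
  constructor
  · intro h
    refine ⟨h 0 (by simp), ?_⟩
    ext i
    exact h _ (by simp)
  · rintro ⟨h0, h1⟩ e he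
    obtain h | h : Finsupp.degree e = 0 ∨ Finsupp.degree e = 1 := by omega
    · rw [Finsupp.degree_eq_zero_iff] at h
      rw [h]; exact h0
    · obtain ⟨i, rfl⟩ := (Finsupp.sum_eq_one_iff e).1 h
      exact congrFun h1 i

variable [Fintype σ]

theorem sub_linear_mem_orderIdeal_two {f : MvPowerSeries σ k} (hf : constantCoeff f = 0) :
    f - ∑ i, linearPart σ k f i • X i ∈ orderIdeal σ k 2 := by
  classical
  rw [mem_orderIdeal_two]
  constructor
  · simp [hf, smul_eq_C_mul]
  · ext j
    simp [linearPart_X, Pi.single_apply]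

theorem linearPart_algHom (T : MvPowerSeries σ k →ₐ[k] MvPowerSeries σ k)
    {f : MvPowerSeries σ k} (hf : constantCoeff f = 0) :
    linearPart σ k (T f) = ∑ i, linearPart σ k f i • linearPart σ k (T (X i)) := by
  have h := (mem_orderIdeal_two.1 (algHom_mem_orderIdeal T (sub_linear_mem_orderIdeal_two hf))).2
  rw [map_sub, map_sub, sub_eq_zero] at h
  rw [h]
  simp

end AlgHom

end MvPowerSeries

open MvPowerSeries in
/-- Formal inverse function theorem: power series without constant term whose linear parts are
linearly independent are coordinates. -/
theorem isPowerSeriesCoordinates_of_linearIndependent {k : Type*} [Field k] {n : ℕ}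
    (y : Fin n → MvPowerSeries (Fin n) k) (hy0 : ∀ i, constantCoeff (y i) = 0)
    (hy : LinearIndependent k fun i => linearPart (Fin n) k (y i)) :
    IsPowerSeriesCoordinates y := by
  have hsub : HasSubst y := hasSubst_of_constantCoeff_zero hy0
  refine ⟨hsub, ?_⟩
  let A : Matrix (Fin n) (Fin n) k := fun i => linearPart (Fin n) k (y i)
  have hA : IsUnit A := Matrix.linearIndependent_rows_iff_isUnit.1 hy
  obtain ⟨B, hAB, hBA⟩ := isUnit_iff_exists.1 hA
  let z : Fin n → MvPowerSeries (Fin n) k := fun i => ∑ j, B i j • X j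
  have hz0 : ∀ i, constantCoeff (z i) = 0 := fun i => by simp [z, smul_eq_C_mul]
  have hzsub : HasSubst z := hasSubst_of_constantCoeff_zero hz0
  have hzl : ∀ i, linearPart (Fin n) k (z i) = B i := fun i => by
    ext j
    simp [z, linearPart_X, Pi.single_apply]
  let T := substAlgHom (R := k) hsub
  let S := substAlgHom (R := k) hzsub
  have hT : ∀ i, T (X i) = y i := substAlgHom_X hsub
  have hS : ∀ i, S (X i) = z i := substAlgHom_X hzsub
  -- With `S` the linear substitution by the inverse matrix, `S ∘ T` and `T ∘ S` are both tangent to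
  -- the identity; the first makes `T` injective, the second surjective.
  have key : ∀ (U V : MvPowerSeries (Fin n) k →ₐ[k] MvPowerSeries (Fin n) k)
      (C D : Matrix (Fin n) (Fin n) k) (_ : ∀ i, linearPart (Fin n) k (U (X i)) = C i)
      (_ : ∀ i, linearPart (Fin n) k (V (X i)) = D i) (_ : D * C = 1),
      Function.Bijective (U.comp V) := by
    intro U V C D hU hV hDC
    refine bijective_of_sub_X_mem_orderIdeal _ fun i => mem_orderIdeal_two.2 ⟨?_, ?_⟩
    · rw [map_sub, constantCoeff_algHom, sub_self]
    · rw [map_sub, sub_eq_zero, AlgHom.comp_apply, linearPart_algHom _ (by simp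
        [constantCoeff_algHom]), linearPart_X]
      ext j
      have := congrFun (congrFun hDC i) j
      rw [Matrix.mul_apply] at this
      simp [hU, hV, this, Matrix.one_apply, Pi.single_apply, eq_comm]
  have h1 := key S T B A (fun i => by rw [hS, hzl]) (fun i => by rw [hT]) hAB
  have h2 := key T S A B (fun i => by rw [hT]) (fun i => by rw [hS, hzl]) hBA
  rw [← coe_substAlgHom hsub]
  rw [AlgHom.coe_comp] at h1 h2
  exact ⟨h1.1.of_comp, h2.2.of_comp⟩

/-! ### Locally finite operators -/

section LocallyFinite

variable {k V : Type*} [Field k] [AddCommGroup V] [Module k V]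

theorem Module.End.exists_aeval_apply_eq_zero (f : Module.End k V) (a : V)
    (h : FiniteDimensional k (Submodule.span k (Set.range fun m : ℕ => (f ^ m) a))) :
    ∃ P : Polynomial k, P ≠ 0 ∧ Polynomial.aeval f P a = 0 := by
  let W := Submodule.span k (Set.range fun m : ℕ => (f ^ m) a)
  let e : Polynomial k →ₗ[k] V :=
    (LinearMap.applyₗ a).comp (Polynomial.aeval (R := k) f).toLinearMap
  have he : ∀ P, e P ∈ W := by
    intro P
    change Polynomial.aeval f P a ∈ W
    rw [Polynomial.aeval_eq_sum_range, LinearMap.sum_apply]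
    refine Submodule.sum_mem _ fun i _ => ?_
    rw [LinearMap.smul_apply]
    exact Submodule.smul_mem _ _ (Submodule.subset_span ⟨i, rfl⟩)
  -- Otherwise the infinite-dimensional `k[X]` embeds in `W` by `P ↦ P(f) a`.
  by_contra! hP
  have hinj : Function.Injective (e.codRestrict W he) := by
    rw [injective_iff_map_eq_zero]
    intro P hP0
    by_contra hne
    exact hP P hne (congrArg Subtype.val hP0)
  have : FiniteDimensional k W := h
  exact Polynomial.not_finite (R := k) (Module.Finite.of_injective _ hinj)

theorem Module.End.iSup_maxGenEigenspace_eq_top_of_locally_finite [IsAlgClosed k]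
    (f : Module.End k V)
    (h : ∀ a, FiniteDimensional k (Submodule.span k (Set.range fun m : ℕ => (f ^ m) a))) :
    ⨆ μ, f.maxGenEigenspace μ = ⊤ := by
  rw [eq_top_iff]
  intro a _
  let W := Submodule.span k (Set.range fun m : ℕ => (f ^ m) a)
  have hfin : FiniteDimensional k W := h a
  have hW : ∀ x ∈ W, f x ∈ W := by
    intro x hx
    refine (Submodule.span_le.2 ?_ : W ≤ W.comap f) hx
    rintro _ ⟨m, rfl⟩
    refine Submodule.subset_span ⟨m + 1, ?_⟩
    simp [pow_succ']
  have ha : a ∈ W := Submodule.subset_span ⟨0, by simp⟩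
  let g : Module.End k W := LinearMap.restrict f hW
  have hmem : (⟨a, ha⟩ : W) ∈ ⨆ μ, g.maxGenEigenspace μ := by
    rw [Module.End.iSup_maxGenEigenspace_eq_top g]
    trivial
  have := Submodule.mem_map_of_mem (f := W.subtype) hmem
  rw [Submodule.map_iSup] at this
  refine (iSup_mono fun μ => ?_ :
    (⨆ μ, (g.maxGenEigenspace μ).map W.subtype) ≤ _) this
  rw [Module.End.maxGenEigenspace, Module.End.genEigenspace_restrict]
  exact Submodule.map_comap_le _ _

end LocallyFinite

theorem AlgHom.toLinearMap_pow_apply {k A : Type*} [Field k] [CommRing A] [Algebra k A]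
    (φ : A →ₐ[k] A) (m : ℕ) (a : A) : ((φ.toLinearMap : Module.End k A) ^ m) a = (φ ^ m) a := by
  induction m generalizing a with
  | zero => simp
  | succ m ih =>
    rw [pow_succ, pow_succ]
    exact ih (φ a)

theorem IsLocallyFiniteEnd.pow {k A : Type*} [Field k] [CommRing A] [Algebra k A]
    {φ : A →ₐ[k] A} (h : IsLocallyFiniteEnd φ) (m : ℕ) : IsLocallyFiniteEnd (φ ^ m) := by
  intro a
  have := h a
  refine Submodule.finiteDimensional_of_le (Submodule.span_mono
    (t := Set.range fun m : ℕ => (φ ^ m) a) ?_)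
  rintro _ ⟨s, rfl⟩
  exact ⟨m * s, by simp [pow_mul]⟩

theorem IsLocallyFiniteEnd.toLinearMap {k A : Type*} [Field k] [CommRing A] [Algebra k A]
    {φ : A →ₐ[k] A} (h : IsLocallyFiniteEnd φ) (a : A) :
    FiniteDimensional k (Submodule.span k
      (Set.range fun m : ℕ => ((φ.toLinearMap : Module.End k A) ^ m) a)) := by
  have heq : (fun m : ℕ => ((φ.toLinearMap : Module.End k A) ^ m) a) = fun m => (φ ^ m) a :=
    funext fun m => φ.toLinearMap_pow_apply m a
  rw [heq]
  exact h a

/-! ### Nonzero eigenvalues are roots of unity -/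

namespace MvPowerSeries

variable {σ k : Type*} [Field k]

theorem exists_order_eq {z : MvPowerSeries σ k} (hz : z ≠ 0) (hz0 : constantCoeff z = 0) :
    ∃ e : ℕ, 1 ≤ e ∧ z ∈ orderIdeal σ k e ∧
      ∀ j d, z ^ j ∈ orderIdeal σ k d → d ≤ j * e := by
  have ho : (z.order.toNat : ℕ∞) = z.order := ne_zero_iff_order_finite.1 hz
  have hpow : ∀ j : ℕ, (z ^ j).order = j * z.order := by
    intro j
    induction j with
    | zero =>
      have : (1 : MvPowerSeries σ k).order = 0 := by
        by_contra h
        rw [← ne_eq, order_ne_zero_iff_constCoeff_eq_zero] at h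
        simp at h
      simp [this]
    | succ j ih => rw [pow_succ, order_mul, ih]; push_cast; ring
  refine ⟨z.order.toNat, ?_, ?_, fun j d h => ?_⟩
  · have := mem_orderIdeal.1 (mem_orderIdeal_one.2 hz0)
    rw [← ho] at this
    exact_mod_cast this
  · rw [mem_orderIdeal, ho]
  · rw [mem_orderIdeal, hpow, ← ho] at h
    exact_mod_cast h

variable [Fintype σ]

theorem aeval_mem_orderIdeal (T : MvPowerSeries σ k →ₐ[k] MvPowerSeries σ k)
    (P : Polynomial k) {d : ℕ} {f : MvPowerSeries σ k} (hf : f ∈ orderIdeal σ k d) :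
    Polynomial.aeval (T.toLinearMap : Module.End k (MvPowerSeries σ k)) P f ∈
      orderIdeal σ k d := by
  rw [Polynomial.aeval_eq_sum_range, LinearMap.sum_apply]
  refine Ideal.sum_mem _ fun i _ => ?_
  rw [LinearMap.smul_apply, AlgHom.toLinearMap_pow_apply]
  exact smul_mem_orderIdeal _ (algHom_mem_orderIdeal _ hf)

/-- A polynomial in a locally finite endomorphism that kills a convergent series `∑ aₗ`: the first
term it does not kill is mapped into the order of the following terms. -/
theorem exists_polynomial_of_isLocallyFiniteEnd {φ : MvPowerSeries σ k →ₐ[k] MvPowerSeries σ k}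
    (hφ : IsLocallyFiniteEnd φ) (a : ℕ → MvPowerSeries σ k) (b : ℕ → ℕ) (hb : Monotone b)
    (hb' : ∀ l, l ≤ b l) (ha : ∀ l, a l ∈ orderIdeal σ k (b l)) :
    ∃ P : Polynomial k, P ≠ 0 ∧ ∀ l₀,
      (∀ l < l₀, Polynomial.aeval (φ.toLinearMap : Module.End k (MvPowerSeries σ k)) P (a l) = 0) →
      Polynomial.aeval (φ.toLinearMap : Module.End k (MvPowerSeries σ k)) P (a l₀) ∈
        orderIdeal σ k (b (l₀ + 1)) := by
  obtain ⟨f, hf⟩ := exists_sub_sum_mem_orderIdeal a b hb hb' ha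
  obtain ⟨P, hP, hPf⟩ := Module.End.exists_aeval_apply_eq_zero
    (φ.toLinearMap : Module.End k (MvPowerSeries σ k)) f (hφ.toLinearMap f)
  refine ⟨P, hP, fun l₀ hl₀ => ?_⟩
  have h := aeval_mem_orderIdeal φ P (hf (l₀ + 1))
  rw [map_sub, hPf, zero_sub, Submodule.neg_mem_iff, map_sum, Finset.sum_range_succ,
    Finset.sum_eq_zero fun l hl => hl₀ l (Finset.mem_range.1 hl), zero_add] at h
  exact h

theorem exists_pow_eq_one_of_eigenvector {φ : MvPowerSeries σ k →ₐ[k] MvPowerSeries σ k}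
    (hφ : IsLocallyFiniteEnd φ) {z : MvPowerSeries σ k} (hz : z ≠ 0) (hz0 : constantCoeff z = 0)
    {μ : k} (hμ : μ ≠ 0) (h : φ z = μ • z) : ∃ m : ℕ, 1 ≤ m ∧ μ ^ m = 1 := by
  obtain ⟨e, he1, hze, hord⟩ := exists_order_eq hz hz0
  obtain ⟨P, hP, hPz⟩ := exists_polynomial_of_isLocallyFiniteEnd hφ (fun j => z ^ j)
    (fun j => j * e) (fun _ _ hij => Nat.mul_le_mul_right _ hij)
    (fun l => Nat.le_mul_of_pos_right _ he1) (fun l => pow_mem_orderIdeal hze l)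
  have haev : ∀ j : ℕ, Polynomial.aeval (φ.toLinearMap : Module.End k (MvPowerSeries σ k)) P
      (z ^ j) = P.eval (μ ^ j) • z ^ j := by
    intro j
    refine Module.End.aeval_apply_of_hasEigenvector ⟨?_, pow_ne_zero _ hz⟩
    rw [Module.End.mem_eigenspace_iff]
    change φ (z ^ j) = _
    rw [map_pow, h, smul_pow]
  have hroot : ∀ j, P.eval (μ ^ j) = 0 := by
    intro j
    induction j using Nat.strong_induction_on with
    | _ j ih =>
      -- If `j` is the first failure, `z ^ j` would have order at least `(j + 1) * e`, whereas its
      -- order is `j * e`.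
      by_contra hne
      have h1 := hPz j fun l hl => by rw [haev, ih l hl, zero_smul]
      rw [haev] at h1
      have h2 := smul_mem_orderIdeal (P.eval (μ ^ j))⁻¹ h1
      rw [smul_smul, inv_mul_cancel₀ hne, one_smul] at h2
      have h3 := hord _ _ h2
      nlinarith
  have hninj : ¬ Function.Injective fun j : ℕ => μ ^ j := fun hinj =>
    hP (Polynomial.eq_zero_of_infinite_isRoot P
      ((Set.infinite_range_of_injective hinj).mono (by rintro _ ⟨j, rfl⟩; exact hroot j)))
  simp only [Function.Injective, not_forall] at hninj
  obtain ⟨i, j, hij, hne⟩ := hninj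
  wlog hlt : i < j generalizing i j
  · exact this j i hij.symm (Ne.symm hne) (by omega)
  refine ⟨j - i, by omega, ?_⟩
  have : μ ^ i * μ ^ (j - i) = μ ^ i * 1 := by
    rw [← pow_add, Nat.add_sub_cancel' hlt.le, mul_one]; exact hij.symm
  exact mul_left_cancel₀ (pow_ne_zero _ hμ) this

end MvPowerSeries

/-! ### No nontrivial Jordan blocks for nonzero eigenvalues -/

section Unipotent

variable {k A : Type*} [Field k] [CommRing A] [Algebra k A]

theorem AlgHom.sub_one_pow_mul_of_fixed (ψ : A →ₐ[k] A) {w : A} (hw : ψ w = w) (j : ℕ) (f : A) :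
    (((ψ.toLinearMap : Module.End k A) - 1) ^ j) (w * f) =
      w * (((ψ.toLinearMap : Module.End k A) - 1) ^ j) f := by
  induction j generalizing f with
  | zero => simp
  | succ j ih =>
    rw [pow_succ, Module.End.mul_apply, Module.End.mul_apply, ← ih]
    congr 1
    simp [hw, mul_sub]

theorem AlgHom.sub_one_apply_pow (ψ : A →ₐ[k] A) {y w : A} (hy : ψ y = y + w) (i : ℕ) :
    ((ψ.toLinearMap : Module.End k A) - 1) (y ^ i) =
      ∑ s ∈ Finset.range i, (w ^ (i - s) * (i.choose s : A)) * y ^ s := by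
  have : ((ψ.toLinearMap : Module.End k A) - 1) (y ^ i) = (y + w) ^ i - y ^ i := by
    simp [hy]
  rw [this, add_pow, Finset.sum_range_succ]
  simp only [Nat.sub_self, pow_zero, mul_one, Nat.choose_self, Nat.cast_one, add_sub_cancel_right]
  exact Finset.sum_congr rfl fun s _ => by ring

/-- `ψ - 1` is a difference operator with step `w`: it is linear over fixed elements and lowers the
degree in `y`. -/
theorem AlgHom.sub_one_pow_apply_pow (ψ : A →ₐ[k] A) {y w : A} (hy : ψ y = y + w)
    (hw : ψ w = w) (j : ℕ) :
    (∀ i < j, (((ψ.toLinearMap : Module.End k A) - 1) ^ j) (y ^ i) = 0) ∧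
      (((ψ.toLinearMap : Module.End k A) - 1) ^ j) (y ^ j) = (j.factorial : A) * w ^ j := by
  have hfix : ∀ a b : ℕ, ψ (w ^ a * (b : A)) = w ^ a * (b : A) := fun a b => by simp [hw]
  induction j with
  | zero => simp
  | succ j ih =>
    have hstep : ∀ i, (((ψ.toLinearMap : Module.End k A) - 1) ^ (j + 1)) (y ^ i) =
        ∑ s ∈ Finset.range i, (w ^ (i - s) * (i.choose s : A)) *
          (((ψ.toLinearMap : Module.End k A) - 1) ^ j) (y ^ s) := by
      intro i
      rw [pow_succ, Module.End.mul_apply, ψ.sub_one_apply_pow hy, map_sum]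
      exact Finset.sum_congr rfl fun s _ => ψ.sub_one_pow_mul_of_fixed (hfix _ _) _ _
    constructor
    · intro i hi
      rw [hstep]
      refine Finset.sum_eq_zero fun s hs => ?_
      rw [ih.1 s (by rw [Finset.mem_range] at hs; omega), mul_zero]
    · rw [hstep, Finset.sum_range_succ, Finset.sum_eq_zero fun s hs => by
        rw [ih.1 s (Finset.mem_range.1 hs), mul_zero], zero_add, ih.2, Nat.factorial_succ]
      simp
      ring

end Unipotent

namespace MvPowerSeries

variable {σ k : Type*} [Field k] [Fintype σ]

theorem eq_zero_of_map_eq_add_of_isLocallyFiniteEnd [CharZero k]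
    {ψ : MvPowerSeries σ k →ₐ[k] MvPowerSeries σ k} (hψ : IsLocallyFiniteEnd ψ)
    {y w : MvPowerSeries σ k} (hy0 : constantCoeff y = 0) (hy : ψ y = y + w) (hw : ψ w = w) :
    w = 0 := by
  by_contra hw0
  have hwc : constantCoeff w = 0 := by
    have := constantCoeff_algHom ψ y
    rwa [hy, map_add, hy0, zero_add] at this
  obtain ⟨e, he1, -, hord⟩ := exists_order_eq hw0 hwc
  -- The exponents grow by the factor `e + 1` because `w ^ j` has order only `j * e`, less than the
  -- next exponent `j * (e + 1)`.
  obtain ⟨P, hP, hPy⟩ := exists_polynomial_of_isLocallyFiniteEnd hψ (fun l => y ^ (e + 1) ^ l)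
    (fun l => (e + 1) ^ l) (pow_right_mono₀ (by omega))
    (fun l => (Nat.lt_pow_self (by omega)).le)
    (fun l => by simpa using pow_mem_orderIdeal (mem_orderIdeal_one.2 hy0) ((e + 1) ^ l))
  obtain ⟨Q, hPQ, hQ⟩ := Polynomial.exists_eq_pow_rootMultiplicity_mul_and_not_dvd P hP 1
  rw [Polynomial.dvd_iff_isRoot, Polynomial.IsRoot.def] at hQ
  set r := P.rootMultiplicity 1
  set Ψ : Module.End k (MvPowerSeries σ k) := ψ.toLinearMap
  have haev : ∀ f, Polynomial.aeval Ψ P f = Polynomial.aeval Ψ Q (((Ψ - 1) ^ r) f) := by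
    intro f
    rw [hPQ, mul_comm, map_mul, map_pow]
    simp
  have hex : ∃ l, r ≤ (e + 1) ^ l := ⟨r, (Nat.lt_pow_self (by omega)).le⟩
  classical
  set l₀ := Nat.find hex
  set j := (e + 1) ^ l₀
  have hrj : r ≤ j := Nat.find_spec hex
  have h1 := hPy l₀ fun l hl => by
    rw [haev, (ψ.sub_one_pow_apply_pow hy hw r).1 _ (not_le.1 (Nat.find_min hex hl)), map_zero]
  -- Since `P = (X - 1)^r Q` with `Q(1) ≠ 0`, applying `j - r` more factors of `Ψ - 1` turns `y ^ j`
  -- into `j! w ^ j`, on which `Q(Ψ)` acts as `Q(1)`.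
  have h2 : ((Ψ - 1) ^ (j - r)) (Polynomial.aeval Ψ P (y ^ j)) =
      (Q.eval 1 * (j.factorial : k)) • w ^ j := by
    have hcomm : ((Ψ - 1) ^ (j - r)) = Polynomial.aeval Ψ ((Polynomial.X - 1 : Polynomial k) ^ (j - r)) := by
      simp
    have hcomb : ∀ f, ((Ψ - 1) ^ (j - r)) (((Ψ - 1) ^ r) f) = ((Ψ - 1) ^ j) f := fun f => by
      rw [← Module.End.mul_apply, ← pow_add, Nat.sub_add_cancel hrj]
    rw [haev, hcomm, ← Module.End.mul_apply, ← map_mul, mul_comm, map_mul, ← hcomm,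
      Module.End.mul_apply, hcomb, (ψ.sub_one_pow_apply_pow hy hw j).2, ← nsmul_eq_mul, map_nsmul,
      Module.End.aeval_apply_of_hasEigenvector (μ := 1) ⟨?_, pow_ne_zero _ hw0⟩]
    · rw [mul_comm, mul_smul, Nat.cast_smul_eq_nsmul]
    · rw [Module.End.mem_eigenspace_iff]
      change ψ (w ^ j) = _
      rw [map_pow, hw, one_smul]
  have h3 : ((Ψ - 1) ^ (j - r)) (Polynomial.aeval Ψ P (y ^ j)) ∈
      orderIdeal σ k ((e + 1) ^ (l₀ + 1)) := by
    have := aeval_mem_orderIdeal ψ ((Polynomial.X - 1) ^ (j - r)) h1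
    simpa using this
  rw [h2] at h3
  have hne : Q.eval 1 * (j.factorial : k) ≠ 0 :=
    mul_ne_zero hQ (Nat.cast_ne_zero.2 (Nat.factorial_ne_zero _))
  have h4 := smul_mem_orderIdeal (Q.eval 1 * (j.factorial : k))⁻¹ h3
  rw [smul_smul, inv_mul_cancel₀ hne, one_smul] at h4
  have h5 := hord _ _ h4
  rw [pow_succ] at h5
  have h6 : 0 < j := by positivity
  have h7 := Nat.le_of_mul_le_mul_left h5 h6
  omega

/-- The power `φ ^ m` is unipotent on the block: `y ↦ y + m μ^(m-1) z`, with nonzero coefficient in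
characteristic zero. -/
theorem eq_zero_of_jordan_block [CharZero k]
    {φ : MvPowerSeries σ k →ₐ[k] MvPowerSeries σ k} (hφ : IsLocallyFiniteEnd φ)
    {y z : MvPowerSeries σ k} (hy0 : constantCoeff y = 0) {μ : k} {m : ℕ} (hm : 1 ≤ m)
    (hμ : μ ^ m = 1) (hy : φ y = μ • y + z) (hz : φ z = μ • z) : z = 0 := by
  have hμ0 : μ ≠ 0 := by
    rintro rfl
    rw [zero_pow (by omega)] at hμ
    exact zero_ne_one hμ
  have hpz : ∀ s : ℕ, (φ ^ s) z = μ ^ s • z := by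
    intro s
    induction s with
    | zero => simp
    | succ s ih => rw [pow_succ', AlgHom.mul_apply, ih, map_smul, hz, smul_smul, ← pow_succ]
  have hpy : ∀ s : ℕ, (φ ^ (s + 1)) y = μ ^ (s + 1) • y + ((s + 1 : k) * μ ^ s) • z := by
    intro s
    induction s with
    | zero => simp [hy]
    | succ s ih =>
      rw [pow_succ', AlgHom.mul_apply, ih, map_add, map_smul, map_smul, hy, hz]
      push_cast
      module
  obtain ⟨s, rfl⟩ : ∃ s, m = s + 1 := ⟨m - 1, by omega⟩
  have h := eq_zero_of_map_eq_add_of_isLocallyFiniteEnd (hφ.pow (s + 1)) hy0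
    (w := ((s + 1 : k) * μ ^ s) • z) (by rw [hpy, hμ, one_smul])
    (by rw [map_smul, hpz, hμ, one_smul])
  refine (smul_eq_zero.1 h).resolve_left (mul_ne_zero ?_ (pow_ne_zero _ hμ0))
  exact_mod_cast Nat.succ_ne_zero s

theorem eigenvector_of_mem_maxGenEigenspace [CharZero k]
    {φ : MvPowerSeries σ k →ₐ[k] MvPowerSeries σ k} (hφ : IsLocallyFiniteEnd φ)
    {y : MvPowerSeries σ k} (hy : y ≠ 0) (hy0 : constantCoeff y = 0) {μ : k} (hμ : μ ≠ 0)
    (h : y ∈ Module.End.maxGenEigenspace (φ.toLinearMap : Module.End k (MvPowerSeries σ k)) μ) :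
    (∃ m : ℕ, 1 ≤ m ∧ μ ^ m = 1) ∧ φ y = μ • y := by
  classical
  set N : Module.End k (MvPowerSeries σ k) := φ.toLinearMap - μ • 1 with hN
  have hNa : ∀ f, N f = φ f - μ • f := fun f => rfl
  have hc : ∀ s : ℕ, constantCoeff ((N ^ s) y) = 0 := by
    intro s
    induction s with
    | zero => simpa using hy0
    | succ s ih =>
      rw [pow_succ', Module.End.mul_apply, hNa, map_sub, constantCoeff_algHom, ih,
        smul_eq_C_mul, map_mul, ih]
      simp
  obtain ⟨s, hs⟩ := (Module.End.mem_maxGenEigenspace _ _ _).1 h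
  have hroot : ∃ m : ℕ, 1 ≤ m ∧ μ ^ m = 1 := by
    have hex : ∃ t, (N ^ t) y = 0 := ⟨s, hs⟩
    obtain ⟨t, ht⟩ : ∃ t, Nat.find hex = t + 1 := by
      refine Nat.exists_eq_succ_of_ne_zero fun h0 => hy ?_
      simpa [h0] using Nat.find_spec hex
    refine exists_pow_eq_one_of_eigenvector hφ (z := (N ^ t) y)
      (Nat.find_min hex (by omega)) (hc t) hμ ?_
    have := Nat.find_spec hex
    rw [ht, pow_succ', Module.End.mul_apply, hNa] at this
    exact sub_eq_zero.1 this
  refine ⟨hroot, ?_⟩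
  obtain ⟨m, hm1, hm⟩ := hroot
  -- The last two nonzero iterates of `N` would form a Jordan block of size two.
  have hsq : ∀ t, (N ^ (t + 1)) y = 0 → N y = 0 := by
    intro t
    induction t with
    | zero => simp
    | succ t ih =>
      intro ht
      refine ih ?_
      rw [pow_succ', Module.End.mul_apply, pow_succ', Module.End.mul_apply] at ht
      rw [pow_succ', Module.End.mul_apply]
      refine eq_zero_of_jordan_block hφ (hc t) hm1 hm ?_ (z := N ((N ^ t) y)) ?_
      · rw [hNa]; ring
      · exact sub_eq_zero.1 ht
  have : N y = 0 := by
    cases s with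
    | zero => exact absurd (by simpa using hs) hy
    | succ s => exact hsq s hs
  exact sub_eq_zero.1 this

theorem span_linearPart_maxGenEigenspace [IsAlgClosed k]
    {φ : MvPowerSeries σ k →ₐ[k] MvPowerSeries σ k} (hφ : IsLocallyFiniteEnd φ) :
    Submodule.span k (linearPart σ k '' {f | constantCoeff f = 0 ∧ ∃ μ, f ∈
      Module.End.maxGenEigenspace (φ.toLinearMap : Module.End k (MvPowerSeries σ k)) μ}) = ⊤ := by
  classical
  set Φ : Module.End k (MvPowerSeries σ k) := φ.toLinearMap
  set S := Submodule.span k (linearPart σ k '' {f | constantCoeff f = 0 ∧ ∃ μ, f ∈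
      Module.End.maxGenEigenspace Φ μ})
  -- `E` removes the constant term; it commutes with `φ`, so it preserves generalized eigenspaces,
  -- and it keeps linear parts.
  let E : Module.End k (MvPowerSeries σ k) :=
    1 - (Algebra.linearMap k (MvPowerSeries σ k)).comp (coeff 0)
  have hE : ∀ f, E f = f - C (constantCoeff f) := by
    intro f
    simp [E, algebraMap_apply]
  have hcomm : Commute Φ E := by
    refine LinearMap.ext fun f => ?_
    rw [Module.End.mul_apply, Module.End.mul_apply, hE, hE]
    change φ _ = φ f - _
    have hC : ∀ c : k, φ (C c) = C c := fun c => by simpa [algebraMap_apply] using φ.commutes c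
    rw [map_sub, hC, show constantCoeff (Φ f) = constantCoeff f from constantCoeff_algHom φ f]
  have hle : (⊤ : Submodule k (MvPowerSeries σ k)) ≤ S.comap (linearPart σ k) := by
    rw [← Module.End.iSup_maxGenEigenspace_eq_top_of_locally_finite Φ hφ.toLinearMap]
    refine iSup_le fun μ f hf => ?_
    have hl : linearPart σ k (E f) = linearPart σ k f := by
      rw [hE, map_sub]
      ext i
      simp [linearPart_apply, coeff_C]
    rw [Submodule.mem_comap, ← hl]
    refine Submodule.subset_span ⟨E f, ⟨?_, μ, ?_⟩, rfl⟩
    · rw [hE, map_sub, constantCoeff_C, sub_self]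
    · exact Module.End.mapsTo_maxGenEigenspace_of_comm hcomm μ hf
  rw [eq_top_iff]
  intro c _
  have := hle (x := ∑ i, c i • X i) trivial
  rw [Submodule.mem_comap, map_sum] at this
  convert this using 1
  ext j
  simp [linearPart_X, Pi.single_apply]

end MvPowerSeries

/-! ### Ordering the coordinates and conclusion -/

theorem exists_perm_iff_lt {n : ℕ} (p : Fin n → Prop) :
    ∃ (d : ℕ) (_ : d ≤ n) (e : Equiv.Perm (Fin n)), ∀ i, p (e i) ↔ (i : ℕ) < d := by
  classical
  have hd : Fintype.card {i // p i} ≤ n := by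
    simpa using Fintype.card_subtype_le p
  have hcard : Fintype.card {i : Fin n // (i : ℕ) < Fintype.card {i // p i}} =
      Fintype.card {i // p i} := by
    rw [Fintype.card_subtype]
    rw [Fin.card_filter_val_lt, min_eq_right hd]
  let e := Fintype.equivOfCardEq hcard
  refine ⟨_, hd, e.extendSubtype, fun i => ⟨fun h => ?_, fun h => e.extendSubtype_mem i h⟩⟩
  by_contra hi
  exact e.extendSubtype_not_mem i hi h

open MvPowerSeries in
theorem theorem2p7 {k : Type*} [Field k] [CharZero k] [IsAlgClosed k] (n : ℕ)
    (φ : MvPowerSeries (Fin n) k →ₐ[k] MvPowerSeries (Fin n) k) (hφ : IsLocallyFiniteEnd φ) :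
    ∃ (N : ℕ) (d : ℕ) (hd : d ≤ n) (c : Fin d → k) (y : Fin n → MvPowerSeries (Fin n) k),
      1 ≤ N ∧
      (∀ i : Fin d, ∃ m : ℕ, 1 ≤ m ∧ c i ^ m = 1) ∧
      IsPowerSeriesCoordinates y ∧
      (∀ i : Fin d, φ (y (Fin.castLE hd i)) = c i • y (Fin.castLE hd i)) ∧
      (∀ i : Fin n, d ≤ (i : ℕ) → (φ ^ N) (y i) = 0) := by
  obtain ⟨b, hb, hspan, hli⟩ := exists_linearIndependent k
    (linearPart (Fin n) k '' {f | constantCoeff f = 0 ∧ ∃ μ, f ∈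
      Module.End.maxGenEigenspace (φ.toLinearMap : Module.End k (MvPowerSeries (Fin n) k)) μ})
  rw [span_linearPart_maxGenEigenspace hφ] at hspan
  let B : Module.Basis b k (Fin n → k) := Module.Basis.mk hli (by rw [Subtype.range_coe, hspan])
  let ε : Fin n ≃ b := (Pi.basisFun k (Fin n)).indexEquiv B
  choose w hw hwl using fun i => hb (ε i).2
  choose hw0 μ hμ using hw
  have hwli : LinearIndependent k fun i => linearPart (Fin n) k (w i) := by
    simp only [hwl]
    exact hli.comp ε ε.injective
  obtain ⟨d, hd, e, he⟩ := exists_perm_iff_lt fun i => μ i ≠ 0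
  have hne : ∀ i, w i ≠ 0 := fun i h => hwli.ne_zero i (by rw [h, map_zero])
  have heig : ∀ i : Fin d, _ := fun i => eigenvector_of_mem_maxGenEigenspace hφ
    (hne (e (Fin.castLE hd i))) (hw0 _) ((he _).2 i.2) (hμ _)
  have hnil : ∀ i : Fin n, ∃ s : ℕ, d ≤ (i : ℕ) → (φ ^ s) (w (e i)) = 0 := by
    intro i
    by_cases hi : d ≤ (i : ℕ)
    · have h0 : μ (e i) = 0 := by
        by_contra h
        exact absurd ((he i).1 h) (by omega)
      have h := hμ (e i)
      rw [h0, Module.End.mem_maxGenEigenspace] at h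
      obtain ⟨s, hs⟩ := h
      refine ⟨s, fun _ => ?_⟩
      rwa [zero_smul, sub_zero, AlgHom.toLinearMap_pow_apply] at hs
    · exact ⟨0, fun h => absurd h hi⟩
  choose s hs using hnil
  -- The sum bounds every nilpotency exponent; the added `1` keeps `N` positive.
  refine ⟨1 + ∑ i, s i, d, hd, fun i => μ (e (Fin.castLE hd i)), fun i => w (e i), by omega,
    fun i => (heig i).1, isPowerSeriesCoordinates_of_linearIndependent _ (fun i => hw0 _)
      (hwli.comp e e.injective), fun i => (heig i).2, fun i hi => ?_⟩
  have hle : s i ≤ 1 + ∑ i, s i :=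
    (Finset.single_le_sum (fun _ _ => Nat.zero_le _) (Finset.mem_univ i)).trans (by omega)
  rw [← Nat.sub_add_cancel hle, pow_add, AlgHom.mul_apply, hs i hi, map_zero]
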